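/- **Setting.** Let $\mathcal X\subseteq\mathbb R^{d_x}$, $\mathcal Y\subseteq\mathbb R^{d_y}$, $\mathcal Z\subseteq\mathbb R^{d_z}$, let $X$ and $Y$ be random vectors on a probability space with values in $\mathcal X$ and $\mathcal Y$, and let $(P_{Y|X=x})_{x\in\mathcal X}$ be a (regular) conditional distribution of $Y$ given $X$. Let $p\ge 0$ and $\iota\ge 0$ be real. For $q\ge 0$ let $\mathcal M^q_d$ be the set of Borel probability measures $P$ on $\mathbb R^d$ with $\int\|t\|^q\,P(dt)<\infty$. The $\|\cdot\|^q$-weak topology on $\mathcal M^q_d$ is the coarsest topology for which $P\mapsto\int h\,dP$ is continuous for every continuous $h:\mathbb R^d\to\mathbb R$ with $|h(t)|\le c_0(\|t\|^q+1)$ for all $t$ and some $c_0>0$. Let $L^p$ be the space of real random variables with finite $p$-th moment on a nonatomic probability space, and let $U$ be a random variable on that space that is uniformly distributed on $[0,1]$. A function $\rho:L^p\to\mathbb R$ is a *convex risk measure* if it is monotone ($\xi\ge\zeta$ a.s. implies $\rho(\xi)\ge\rho(\zeta)$), cash invariant ($\rho(\xi+a)=\rho(\xi)+a$ for $a\in\mathbb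 R$) and convex; it is *law invariant* if $\rho(\xi)=\rho(\zeta)$ whenever $\xi,\zeta\in L^p$ have the same distribution. For $m\in\mathcal M^p_1$ with distribution function $F_m$ put $F_m^{-1}(u)=\inf\{t: F_m(t)\ge u\}$ and $\varrho(m)=\rho(F_m^{-1}(U))$. For a probability measure $Q$ on $\mathcal Y$ and $\varphi\in L^p(Q)$ put $\rho_Q(\varphi(Y))=\varrho(Q\circ\varphi^{-1})$. **Assumption 1.** (a) $\rho=\rho^{(2)}$ is a law-invariant convex risk measure on $L^p$. (b) $g:\mathcal X\to\mathcal Z$ is continuous. (c) $c$ is continuous on $\mathcal Z\times\mathcal Y$, and there is a non-negative, locally bounded function $\eta:\mathcal Z\to\mathbb R$ with $|c(z,y)|\le\eta(z)(\|y\|^\iota+1)$ for all $(z,y)\in\mathcal Z\times\mathcal Y$. (d) $P_{Y|X=x}$, regarded as a measure on $\mathbb R^{d_y}$, belongs to $\mathcal M^{\iota p}_{d_y}$ for every $x\in\mathcal X$, and $x\mapsto P_{Y|X=x}$ is continuous on $\mathcal X$ with respect to the $\|\cdot\|^{\iota p}$-weak topology. **Proposition.** Under Assumption 1, $c(g(x),\cdot)\in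 L^p(P_{Y|X=x})$ for every $x\in\mathcal X$, and the map $x\mapsto\rho^{(2)}_{P_{Y|X=x}}\big(c(g(x),Y)\big)$ from $\mathcal X$ to $\mathbb R$ is continuous. -/

import Mathlib

open MeasureTheory ProbabilityTheory Topology
open scoped ENNReal

noncomputable section

/-- The set `𝓜^q_d` of Borel probability measures on `ℝ^d` with finite `q`-th absolute moment. -/
structure MomentMeasure (d : ℕ) (q : ℝ) where
  law : Measure (EuclideanSpace ℝ (Fin d))
  isProbabilityMeasure : IsProbabilityMeasure law
  integrable_moment : Integrable (fun t => ‖t‖ ^ q) law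

/-- The continuous functions `h : ℝ^d → ℝ` with `|h t| ≤ c₀ (‖t‖^q + 1)` for some `c₀ > 0`. -/
def growthFunctions (d : ℕ) (q : ℝ) : Set (EuclideanSpace ℝ (Fin d) → ℝ) :=
  {h | Continuous h ∧ ∃ c₀ : ℝ, 0 < c₀ ∧ ∀ t, |h t| ≤ c₀ * (‖t‖ ^ q + 1)}

/-- The `‖·‖^q`-weak topology on `𝓜^q_d`: the coarsest topology making `P ↦ ∫ h dP` continuous
for every continuous `h` with growth of order `q`. -/
instance MomentMeasure.instTopologicalSpace (d : ℕ) (q : ℝ) :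
    TopologicalSpace (MomentMeasure d q) :=
  ⨅ h ∈ growthFunctions d q,
    TopologicalSpace.induced (fun P : MomentMeasure d q => ∫ t, h t ∂P.law) inferInstance

/-- A family `Q x` of measures on a subset `𝒴` of `ℝ^d`, regarded as measures on `ℝ^d`, has all its
members in `𝓜^q_d` and depends continuously on `x` in the `‖·‖^q`-weak topology. -/
def IsMomentWeaklyContinuous {T : Type*} [TopologicalSpace T] {d : ℕ}
    {𝒴 : Set (EuclideanSpace ℝ (Fin d))} (q : ℝ) (Q : T → Measure 𝒴) : Prop :=
  ∃ M : T → MomentMeasure d q, (∀ x, (M x).law = (Q x).map Subtype.val) ∧ Continuous M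

/-- Every point has a neighbourhood on which `η` is bounded. -/
def IsLocallyBounded {T : Type*} [TopologicalSpace T] (η : T → ℝ) : Prop :=
  ∀ z, ∃ s ∈ 𝓝 z, ∃ b : ℝ, ∀ w ∈ s, |η w| ≤ b

/-- `ρ` is a (real-valued) convex risk measure on `L^p(S, ν)`. Only its values at random variables
with finite `p`-th moment matter. -/
structure IsConvexRiskMeasure {S : Type*} [MeasurableSpace S] (ν : Measure S) (p : ℝ)
    (ρ : (S → ℝ) → ℝ) : Prop where
  monotone : ∀ ξ ζ : S → ℝ, MemLp ξ (ENNReal.ofReal p) ν → MemLp ζ (ENNReal.ofReal p) ν →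
    (∀ᵐ s ∂ν, ζ s ≤ ξ s) → ρ ζ ≤ ρ ξ
  cash_invariant : ∀ ξ : S → ℝ, MemLp ξ (ENNReal.ofReal p) ν → ∀ a : ℝ,
    ρ (fun s => ξ s + a) = ρ ξ + a
  convex : ∀ ξ ζ : S → ℝ, MemLp ξ (ENNReal.ofReal p) ν → MemLp ζ (ENNReal.ofReal p) ν →
    ∀ l : ℝ, 0 ≤ l → l ≤ 1 →
      ρ (fun s => l * ξ s + (1 - l) * ζ s) ≤ l * ρ ξ + (1 - l) * ρ ζ

/-- `ρ` takes equal values at elements of `L^p(S, ν)` that have the same distribution. -/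
def IsLawInvariant {S : Type*} [MeasurableSpace S] (ν : Measure S) (p : ℝ)
    (ρ : (S → ℝ) → ℝ) : Prop :=
  ∀ ξ ζ : S → ℝ, MemLp ξ (ENNReal.ofReal p) ν → MemLp ζ (ENNReal.ofReal p) ν →
    ν.map ξ = ν.map ζ → ρ ξ = ρ ζ

/-- The quantile function `u ↦ inf {t | F(t) ≥ u}` of a probability measure on `ℝ` with
distribution function `F`. -/
def quantile (m : Measure ℝ) (u : ℝ) : ℝ := sInf {t : ℝ | u ≤ cdf m t}

/-- The functional `ϱ` on distributions induced by `ρ` through a uniformly distributed random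
variable `U`: `ϱ(m) = ρ(F_m⁻¹(U))`. -/
def riskOfLaw {S : Type*} (ρ : (S → ℝ) → ℝ) (U : S → ℝ) (m : Measure ℝ) : ℝ :=
  ρ (fun s => quantile m (U s))

/-- The risk `ρ_Q(φ) = ϱ(Q ∘ φ⁻¹)` of a loss `φ` when its argument has distribution `Q`. -/
def riskUnder {S : Type*} (ρ : (S → ℝ) → ℝ) (U : S → ℝ) {T : Type*} [MeasurableSpace T]
    (Q : Measure T) (φ : T → ℝ) : ℝ :=
  riskOfLaw ρ U (Q.map φ)

end

/-!
A risk `ρ_Q(φ(Y))` depends only on the law of the loss `φ(Y)`, through the quantile transform, so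
continuity in `x` splits into two statements about a convergent sequence `xₙ → x`.

*The laws of the costs converge.* The joint laws `δ_{xₙ} ⊗ κ xₙ` converge weakly on `𝒳 × 𝒴`
(`IsMomentWeaklyContinuous.continuous_probabilityMeasure`, `continuous_diracProba_prod`), hence so do
their images under the continuous function `(x, y) ↦ c (g x, y)`. The `p`-th absolute moments of
these images converge too: `|c (g x, y)| ^ p` is locally dominated by a multiple of
`‖y‖ ^ (ι p) + 1`, whose integrals converge by assumption
(`tendsto_lintegral_of_le_of_tendsto_lintegral`).

*The functional `ϱ` is continuous for this mode of convergence* (`tendsto_riskOfLaw`). Weak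
convergence gives almost sure convergence of the quantile transforms (`ae_tendsto_quantile`),
and convergence of moments upgrades this to convergence in `L^p`
(`tendsto_lintegral_enorm_sub_rpow`). Norm continuity of `ρ` is not needed in general: along a
subsequence the transforms `ξₖ` satisfy `|ξₖ - ξ| ≤ ζ / (k + 1)` for one `ζ ∈ L^p`
(`exists_subseq_mul_abs_sub_le`), so monotonicity confines `ρ ξₖ` between `ρ (ξ - ζ / (k + 1))` and
`ρ (ξ + ζ / (k + 1))`, and `t ↦ ρ (ξ + t ζ)` is continuous, being a finite convex function on `ℝ`
(`IsConvexRiskMeasure.tendsto_of_mul_abs_sub_le`). This argument covers all `p ≥ 0` at once, also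
the range `p < 1` in which `L^p` is not normed.
-/

noncomputable section

open Filter Set

/-! ### Convergence of lower semicontinuous quantities with convergent sum -/

theorem ENNReal.tendsto_of_le_liminf_of_tendsto_add {a b : ℕ → ℝ≥0∞} {a₀ b₀ : ℝ≥0∞}
    (ha : a₀ ≤ liminf a atTop) (hb : b₀ ≤ liminf b atTop)
    (hab : Tendsto (fun n => a n + b n) atTop (𝓝 (a₀ + b₀))) (hb₀ : b₀ ≠ ∞) :
    Tendsto a atTop (𝓝 a₀) := by
  refine tendsto_of_le_liminf_of_limsup_le ha ?_
  rcases eq_or_ne a₀ ∞ with rfl | ha₀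
  · exact le_top
  have key : ∀ ε : ℝ≥0∞, ε ≠ 0 → ε ≠ ∞ → limsup a atTop ≤ a₀ + 2 * ε := by
    intro ε hε hε'
    have h1 : ∀ᶠ n in atTop, b₀ ≤ b n + ε := by
      rcases le_or_gt b₀ ε with h | h
      · exact Eventually.of_forall fun n => h.trans le_add_self
      · have hlt : b₀ - ε < liminf b atTop :=
          (ENNReal.sub_lt_self hb₀ ((pos_iff_ne_zero.2 hε).trans h).ne' hε).trans_le hb
        filter_upwards [eventually_lt_of_lt_liminf hlt] with n hn
        exact tsub_le_iff_right.1 hn.le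
    have h2 : ∀ᶠ n in atTop, a n + b n < a₀ + b₀ + ε :=
      hab.eventually (gt_mem_nhds (ENNReal.lt_add_right (ENNReal.add_ne_top.2 ⟨ha₀, hb₀⟩) hε))
    refine limsup_le_of_le (by isBoundedDefault) ?_
    filter_upwards [h1, h2] with n hn1 hn2
    refine (ENNReal.add_le_add_iff_right hb₀).1 ?_
    calc a n + b₀ ≤ a n + b n + ε := by rw [add_assoc]; gcongr
      _ ≤ a₀ + b₀ + ε + ε := by gcongr
      _ = a₀ + 2 * ε + b₀ := by ring
  refine ENNReal.le_of_forall_pos_le_add fun ε hε _ => ?_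
  have h := key (ε / 2 : ℝ≥0∞) (by simp [hε.ne']) (ENNReal.div_ne_top (by simp) (by simp))
  rwa [ENNReal.mul_div_cancel (by simp) (by simp)] at h

/-- Let `μs n` converge to `μ` in the sense of the open-set half of the portmanteau theorem. Then
the integrals of a nonnegative continuous `f` converge as soon as those of a continuous majorant
`g` do: both `∫ f` and `∫ (g - f)` are lower semicontinuous. -/
theorem tendsto_lintegral_of_le_of_tendsto_lintegral {T : Type*} [TopologicalSpace T]
    [MeasurableSpace T] [OpensMeasurableSpace T] {μ : Measure T} {μs : ℕ → Measure T}
    (hopen : ∀ G, IsOpen G → μ G ≤ liminf (fun n => μs n G) atTop) {f g : T → ℝ}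
    (hf : Continuous f) (hg : Continuous g) (hf₀ : 0 ≤ f)
    (hfg : ∀ᵐ t ∂μ, f t ≤ g t) (hfgs : ∀ᶠ n in atTop, ∀ᵐ t ∂μs n, f t ≤ g t)
    (hlim : Tendsto (fun n => ∫⁻ t, ENNReal.ofReal (g t) ∂μs n) atTop
      (𝓝 (∫⁻ t, ENNReal.ofReal (g t) ∂μ)))
    (hfin : ∫⁻ t, ENNReal.ofReal (g t) ∂μ ≠ ∞) :
    Tendsto (fun n => ∫⁻ t, ENNReal.ofReal (f t) ∂μs n) atTop
      (𝓝 (∫⁻ t, ENNReal.ofReal (f t) ∂μ)) := by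
  -- The difference is truncated at zero because `f ≤ g` holds only almost everywhere.
  set r : T → ℝ := fun t => max (g t - f t) 0 with hr
  have hr_cont : Continuous r := (hg.sub hf).max continuous_const
  have hr₀ : 0 ≤ r := fun t => le_max_right _ _
  have hadd : ∀ m : Measure T, (∀ᵐ t ∂m, f t ≤ g t) →
      ∫⁻ t, ENNReal.ofReal (f t) ∂m + ∫⁻ t, ENNReal.ofReal (r t) ∂m
        = ∫⁻ t, ENNReal.ofReal (g t) ∂m := by
    intro m hm
    rw [← lintegral_add_left hf.measurable.ennreal_ofReal]
    refine lintegral_congr_ae ?_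
    filter_upwards [hm] with t ht
    rw [← ENNReal.ofReal_add (hf₀ t) (hr₀ t), hr]
    simp only
    rw [max_eq_left (sub_nonneg.2 ht), add_sub_cancel]
  refine ENNReal.tendsto_of_le_liminf_of_tendsto_add
    (lintegral_le_liminf_lintegral_of_forall_isOpen_measure_le_liminf_measure hf hf₀ hopen)
    (lintegral_le_liminf_lintegral_of_forall_isOpen_measure_le_liminf_measure hr_cont hr₀ hopen)
    ?_ ?_
  · rw [hadd μ hfg]
    refine hlim.congr' ?_
    filter_upwards [hfgs] with n hn
    exact (hadd _ hn).symm
  · rw [← hadd μ hfg] at hfin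
    exact (ENNReal.add_ne_top.1 hfin).2

/-- The Riesz–Scheffé lemma: almost everywhere convergence together with convergence of the `p`-th
absolute moments implies convergence in `L^p`. -/
theorem tendsto_lintegral_enorm_sub_rpow {S : Type*} [MeasurableSpace S] {ν : Measure S} {p : ℝ}
    (hp : 0 < p) {ξs : ℕ → S → ℝ} {ξ : S → ℝ} (hξs : ∀ n, AEMeasurable (ξs n) ν)
    (hξ : AEMeasurable ξ ν) (hae : ∀ᵐ s ∂ν, Tendsto (fun n => ξs n s) atTop (𝓝 (ξ s)))
    (hmom : Tendsto (fun n => ∫⁻ s, ‖ξs n s‖ₑ ^ p ∂ν) atTop (𝓝 (∫⁻ s, ‖ξ s‖ₑ ^ p ∂ν)))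
    (hfin : ∫⁻ s, ‖ξ s‖ₑ ^ p ∂ν ≠ ∞) :
    Tendsto (fun n => ∫⁻ s, ‖ξs n s - ξ s‖ₑ ^ p ∂ν) atTop (𝓝 0) := by
  have hC : (2 : ℝ≥0∞) ^ p ≠ ∞ := ENNReal.rpow_ne_top_of_nonneg hp.le (by simp)
  have hbound : ∀ a b : ℝ, ‖a - b‖ₑ ^ p ≤ 2 ^ p * (‖a‖ₑ ^ p + ‖b‖ₑ ^ p) := by
    intro a b
    have h1 : ‖a - b‖ₑ ≤ 2 * max ‖a‖ₑ ‖b‖ₑ := by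
      rw [two_mul]
      exact enorm_sub_le.trans (add_le_add (le_max_left _ _) (le_max_right _ _))
    calc ‖a - b‖ₑ ^ p ≤ (2 * max ‖a‖ₑ ‖b‖ₑ) ^ p := ENNReal.rpow_le_rpow h1 hp.le
      _ = 2 ^ p * max ‖a‖ₑ ‖b‖ₑ ^ p := ENNReal.mul_rpow_of_nonneg _ _ hp.le
      _ ≤ 2 ^ p * (‖a‖ₑ ^ p + ‖b‖ₑ ^ p) := by
          gcongr
          rcases max_cases ‖a‖ₑ ‖b‖ₑ with h | h <;> rw [h.1]
          · exact le_self_add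
          · exact le_add_self
  set D : ℕ → S → ℝ≥0∞ := fun n s => ‖ξs n s - ξ s‖ₑ ^ p with hD
  set G : ℕ → S → ℝ≥0∞ := fun n s => 2 ^ p * (‖ξs n s‖ₑ ^ p + ‖ξ s‖ₑ ^ p) with hG
  set G₀ : S → ℝ≥0∞ := fun s => 2 ^ p * (‖ξ s‖ₑ ^ p + ‖ξ s‖ₑ ^ p) with hG₀
  have mD : ∀ n, AEMeasurable (D n) ν := fun n =>
    (((hξs n).sub hξ).enorm).pow_const p
  have mG : ∀ n, AEMeasurable (G n) ν := fun n =>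
    ((((hξs n).enorm).pow_const p).add ((hξ.enorm).pow_const p)).const_mul _
  have iG : ∀ n, ∫⁻ s, G n s ∂ν = 2 ^ p * (∫⁻ s, ‖ξs n s‖ₑ ^ p ∂ν + ∫⁻ s, ‖ξ s‖ₑ ^ p ∂ν) := by
    intro n
    rw [hG, lintegral_const_mul' _ _ hC, lintegral_add_right' _ ((hξ.enorm).pow_const p)]
  have iG₀ : ∫⁻ s, G₀ s ∂ν = 2 ^ p * (∫⁻ s, ‖ξ s‖ₑ ^ p ∂ν + ∫⁻ s, ‖ξ s‖ₑ ^ p ∂ν) := by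
    rw [hG₀, lintegral_const_mul' _ _ hC, lintegral_add_right' _ ((hξ.enorm).pow_const p)]
  refine ENNReal.tendsto_of_le_liminf_of_tendsto_add (b := fun n => ∫⁻ s, (G n s - D n s) ∂ν)
    (b₀ := ∫⁻ s, G₀ s ∂ν) zero_le ?_ ?_ ?_
  · refine le_trans (lintegral_mono_ae ?_) (lintegral_liminf_le' fun n => (mG n).sub (mD n))
    filter_upwards [hae] with s hs
    have h1 : Tendsto (fun n => D n s) atTop (𝓝 0) := by
      have h := (((hs.sub_const (ξ s)).enorm).ennrpow_const p)
      simpa [hD, hp] using h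
    have h2 : Tendsto (fun n => G n s) atTop (𝓝 (G₀ s)) :=
      ENNReal.Tendsto.const_mul (((hs.enorm).ennrpow_const p).add_const _) (Or.inr hC)
    have h3 := ENNReal.Tendsto.sub h2 h1 (Or.inr (by simp))
    rw [tsub_zero] at h3
    exact h3.liminf_eq.ge
  · have h : ∀ n, ∫⁻ s, D n s ∂ν + ∫⁻ s, (G n s - D n s) ∂ν = ∫⁻ s, G n s ∂ν := by
      intro n
      rw [← lintegral_add_left' (mD n)]
      exact lintegral_congr fun s => add_tsub_cancel_of_le (hbound _ _)
    simp only [zero_add]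
    have h' : (fun n => ∫⁻ s, ‖ξs n s - ξ s‖ₑ ^ p ∂ν + ∫⁻ s, (G n s - D n s) ∂ν)
        = fun n => ∫⁻ s, G n s ∂ν := funext h
    rw [h', iG₀]
    simp only [iG]
    exact ENNReal.Tendsto.const_mul (hmom.add_const _) (Or.inr hC)
  · rw [iG₀]
    exact ENNReal.mul_ne_top hC (ENNReal.add_ne_top.2 ⟨hfin, hfin⟩)

/-! ### Quantile functions -/

/-- The Galois connection between the quantile function and the distribution function. -/
theorem quantile_le_iff (m : Measure ℝ) {u : ℝ} (h₀ : 0 < u) (h₁ : u < 1) (t : ℝ) :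
    quantile m u ≤ t ↔ u ≤ cdf m t := by
  obtain ⟨b, hb⟩ : ∃ b, cdf m b < u := ((tendsto_cdf_atBot m).eventually (gt_mem_nhds h₀)).exists
  obtain ⟨d, hd⟩ : ∃ d, u < cdf m d := ((tendsto_cdf_atTop m).eventually (lt_mem_nhds h₁)).exists
  have hbdd : BddBelow {t : ℝ | u ≤ cdf m t} :=
    ⟨b, fun t ht => le_of_not_gt fun htb => (ht.trans (monotone_cdf m htb.le)).not_gt hb⟩
  have hne : {t : ℝ | u ≤ cdf m t}.Nonempty := ⟨d, hd.le⟩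
  refine ⟨fun h => ?_, fun h => csInf_le hbdd h⟩
  refine le_trans ?_ (monotone_cdf m h)
  -- The infimum is attained because `cdf m` is right-continuous.
  have hcont : Tendsto (cdf m) (𝓝[>] (quantile m u)) (𝓝 (cdf m (quantile m u))) :=
    ((cdf m).right_continuous _).mono Ioi_subset_Ici_self
  refine ge_of_tendsto hcont ?_
  filter_upwards [self_mem_nhdsWithin] with t ht
  obtain ⟨r, hr, hrt⟩ := exists_lt_of_csInf_lt hne ht
  exact hr.trans (monotone_cdf m hrt.le)

theorem monotoneOn_quantile (m : Measure ℝ) : MonotoneOn (quantile m) (Ioo 0 1) :=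
  fun _ hu _ hv huv => (quantile_le_iff m hu.1 hu.2 _).2
    (huv.trans ((quantile_le_iff m hv.1 hv.2 _).1 le_rfl))

theorem aemeasurable_quantile (m : Measure ℝ) :
    AEMeasurable (quantile m) (volume.restrict (Ioo 0 1)) :=
  aemeasurable_restrict_of_monotoneOn measurableSet_Ioo (monotoneOn_quantile m)

theorem map_quantile (m : Measure ℝ) [IsProbabilityMeasure m] :
    (volume.restrict (Ioo (0 : ℝ) 1)).map (quantile m) = m := by
  symm
  refine Measure.ext_of_Iic _ _ fun t => ?_
  rw [Measure.map_apply_of_aemeasurable (aemeasurable_quantile m) measurableSet_Iic,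
    Measure.restrict_apply' measurableSet_Ioo, ← ofReal_cdf m t]
  have hset : quantile m ⁻¹' Iic t ∩ Ioo 0 1 = Ioo 0 1 ∩ Iic (cdf m t) := by
    ext u
    constructor
    · rintro ⟨h, hu⟩
      exact ⟨hu, (quantile_le_iff m hu.1 hu.2 t).1 h⟩
    · rintro ⟨hu, h⟩
      exact ⟨(quantile_le_iff m hu.1 hu.2 t).2 h, hu⟩
  rw [hset]
  refine le_antisymm ?_ ?_
  · calc ENNReal.ofReal (cdf m t) = volume (Ioo 0 (cdf m t)) := by simp
      _ ≤ volume (Ioo 0 1 ∩ Iic (cdf m t)) := measure_mono fun u hu =>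
          ⟨⟨hu.1, hu.2.trans_le (cdf_le_one m t)⟩, hu.2.le⟩
  · calc _ ≤ volume (Ioc 0 (cdf m t)) := measure_mono fun u hu => ⟨hu.1.1, hu.2⟩
      _ = _ := by simp

/-- Weak convergence implies convergence of the quantile functions at every continuity point of
the limit. -/
theorem tendsto_quantile {m : ProbabilityMeasure ℝ} {ms : ℕ → ProbabilityMeasure ℝ}
    (hm : Tendsto ms atTop (𝓝 m)) {u : ℝ} (hu : u ∈ Ioo (0 : ℝ) 1)
    (hcont : ContinuousWithinAt (quantile m) (Ioo 0 1) u) :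
    Tendsto (fun n => quantile (ms n) u) atTop (𝓝 (quantile m u)) := by
  have hq : ContinuousAt (quantile m) u := hcont.continuousAt (Ioo_mem_nhds hu.1 hu.2)
  refine tendsto_order.2 ⟨fun a ha => ?_, fun b hb => ?_⟩
  · have h1 : (m : Measure ℝ) (Iic a) < ENNReal.ofReal u := by
      rw [← ofReal_cdf]
      refine (ENNReal.ofReal_lt_ofReal_iff hu.1).2 (lt_of_not_ge fun h => ?_)
      exact ((quantile_le_iff _ hu.1 hu.2 a).2 h).not_gt ha
    have h2 := (ProbabilityMeasure.limsup_measure_closed_le_of_tendsto hm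
      (isClosed_Iic (a := a))).trans_lt h1
    filter_upwards [eventually_lt_of_limsup_lt h2] with n hn
    rw [← ofReal_cdf] at hn
    refine lt_of_not_ge fun h => hn.not_ge ?_
    exact ENNReal.ofReal_le_ofReal ((quantile_le_iff _ hu.1 hu.2 a).1 h)
  · obtain ⟨t, hqt, htb⟩ := exists_between hb
    obtain ⟨r, htr, hrb⟩ := exists_between htb
    -- Continuity at `u` rules out that the distribution function of `m` is flat to the right of
    -- `quantile m u`.
    obtain ⟨v, hv, huv, hv1⟩ : ∃ v, quantile m v < t ∧ u < v ∧ v < 1 := by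
      have h1 : ∀ᶠ v in 𝓝[>] u, quantile m v < t :=
        (hq.eventually (gt_mem_nhds hqt)).filter_mono nhdsWithin_le_nhds
      have h2 : ∀ᶠ v in 𝓝[>] u, v ∈ Ioo u 1 := Ioo_mem_nhdsGT hu.2
      obtain ⟨v, hv, hv'⟩ := (h1.and h2).exists
      exact ⟨v, hv, hv'⟩
    have h1 : ENNReal.ofReal u < (m : Measure ℝ) (Iio r) := by
      calc ENNReal.ofReal u < ENNReal.ofReal (cdf m t) := by
            have h := (quantile_le_iff m (hu.1.trans huv) hv1 t).1 hv.le
            exact (ENNReal.ofReal_lt_ofReal_iff (hu.1.trans (huv.trans_le h))).2 (huv.trans_le h)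
        _ = (m : Measure ℝ) (Iic t) := ofReal_cdf _ _
        _ ≤ (m : Measure ℝ) (Iio r) := measure_mono fun x hx => lt_of_le_of_lt hx htr
    have h2 := h1.trans_le (ProbabilityMeasure.le_liminf_measure_open_of_tendsto hm
      (isOpen_Iio (a := r)))
    filter_upwards [eventually_lt_of_lt_liminf h2] with n hn
    refine lt_of_le_of_lt ((quantile_le_iff _ hu.1 hu.2 r).2 ?_) hrb
    have h3 : ENNReal.ofReal u ≤ ENNReal.ofReal (cdf (ms n : Measure ℝ) r) := by
      rw [ofReal_cdf]
      exact hn.le.trans (measure_mono Iio_subset_Iic_self)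
    exact (ENNReal.ofReal_le_ofReal_iff (cdf_nonneg _ _)).1 h3

theorem ae_tendsto_quantile {m : ProbabilityMeasure ℝ} {ms : ℕ → ProbabilityMeasure ℝ}
    (hm : Tendsto ms atTop (𝓝 m)) :
    ∀ᵐ u ∂(volume.restrict (Ioo (0 : ℝ) 1)),
      Tendsto (fun n => quantile (ms n) u) atTop (𝓝 (quantile m u)) := by
  rw [ae_restrict_iff' measurableSet_Ioo]
  filter_upwards [((monotoneOn_quantile (m : Measure ℝ)).countable_not_continuousWithinAt).ae_notMem
    volume] with u hu hu'
  exact tendsto_quantile hm hu' (by by_contra h; exact hu ⟨hu', h⟩)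

/-! ### Continuity of convex risk measures along sequences -/

/-- A sequence converging almost everywhere and in `L^p` has a subsequence which converges with
rate `1 / (k + 1)` relative to a fixed element `ζ` of `L^p`. The case `p = 0`, in which `L^p`
consists of all random variables and only almost everywhere convergence is assumed, is included:
there `ζ` is finite by the Borel–Cantelli lemma. The indices `φ k` need not increase, the rate
making this superfluous. -/
theorem exists_subseq_mul_abs_sub_le {S : Type*} [MeasurableSpace S] {ν : Measure S}
    [IsFiniteMeasure ν] {p : ℝ} (hp : 0 ≤ p) {ξs : ℕ → S → ℝ} {ξ : S → ℝ}
    (hξs : ∀ n, AEMeasurable (ξs n) ν) (hξ : AEMeasurable ξ ν)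
    (hae : ∀ᵐ s ∂ν, Tendsto (fun n => ξs n s) atTop (𝓝 (ξ s)))
    (hLp : 0 < p → Tendsto (fun n => ∫⁻ s, ‖ξs n s - ξ s‖ₑ ^ p ∂ν) atTop (𝓝 0)) :
    ∃ φ : ℕ → ℕ, ∃ ζ : S → ℝ, MemLp ζ (ENNReal.ofReal p) ν ∧
      ∀ᵐ s ∂ν, ∀ k : ℕ, ((k : ℝ) + 1) * |ξs (φ k) s - ξ s| ≤ ζ s := by
  have hpow : ∀ k : ℕ, (0 : ℝ≥0∞) < (1 / 2) ^ k := fun k => ENNReal.pow_pos (by simp) k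
  have hsum : ∑' k : ℕ, ((1 : ℝ≥0∞) / 2) ^ k ≠ ∞ := by
    rw [ENNReal.tsum_geometric]
    simp
  have hmeas := tendstoInMeasure_of_tendsto_ae (fun n => (hξs n).aestronglyMeasurable) hae
  obtain ⟨φ, -, hφ⟩ := extraction_forall_of_eventually
    (P := fun k n => ν {s | ((k : ℝ≥0∞) + 1)⁻¹ ≤ edist (ξs n s) (ξ s)} ≤ (1 / 2) ^ k ∧
      (0 < p → ((k : ℝ≥0∞) + 1) ^ p * ∫⁻ s, ‖ξs n s - ξ s‖ₑ ^ p ∂ν ≤ (1 / 2) ^ k)) (by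
    intro k
    have hk : ((k : ℝ≥0∞) + 1) ≠ ∞ := by simp
    refine (((hmeas _ (ENNReal.inv_pos.2 hk)).eventually (gt_mem_nhds (hpow k))).mono
      fun _ h => h.le).and ?_
    rcases hp.eq_or_lt with h0 | h0
    · exact Eventually.of_forall fun n hn => absurd hn (by simp [← h0])
    · have h1 : Tendsto (fun n => ((k : ℝ≥0∞) + 1) ^ p * ∫⁻ s, ‖ξs n s - ξ s‖ₑ ^ p ∂ν) atTop
          (𝓝 0) := by
        have h := ENNReal.Tendsto.const_mul (a := ((k : ℝ≥0∞) + 1) ^ p) (hLp h0)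
          (Or.inr (ENNReal.rpow_ne_top_of_nonneg hp hk))
        rwa [mul_zero] at h
      exact (h1.eventually (gt_mem_nhds (hpow k))).mono fun _ h _ => h.le)
  set d : ℕ → S → ℝ≥0∞ := fun k s => ((k : ℝ≥0∞) + 1) * ‖ξs (φ k) s - ξ s‖ₑ with hd
  have md : ∀ k, AEMeasurable (d k) ν := fun k => (((hξs _).sub hξ).enorm).const_mul _
  have msup : AEMeasurable (fun s => ⨆ k, d k s) ν := .iSup md
  have hd_top : ∀ k s, d k s ≠ ∞ := fun k s => ENNReal.mul_ne_top (by simp) enorm_ne_top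
  have hsup : ∀ᵐ s ∂ν, ⨆ k, d k s ≠ ∞ := by
    have hbc := ae_eventually_notMem (μ := ν)
      (s := fun k : ℕ => {s | ((k : ℝ≥0∞) + 1)⁻¹ ≤ edist (ξs (φ k) s) (ξ s)})
      (ne_top_of_le_ne_top hsum (ENNReal.tsum_le_tsum fun k => (hφ k).1))
    filter_upwards [hbc] with s hs
    obtain ⟨N, hN⟩ := eventually_atTop.1 hs
    -- All but finitely many terms are at most `1`.
    have hle : ⨆ k, d k s ≤ 1 + ∑ k ∈ Finset.range N, d k s := by
      refine iSup_le fun k => ?_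
      rcases lt_or_ge k N with hk | hk
      · exact (Finset.single_le_sum (f := fun k => d k s) (fun _ _ => zero_le)
          (Finset.mem_range.2 hk)).trans le_add_self
      · have h := hN k hk
        simp only [not_le, edist_eq_enorm_sub] at h
        refine le_trans ?_ le_self_add
        calc d k s ≤ ((k : ℝ≥0∞) + 1) * ((k : ℝ≥0∞) + 1)⁻¹ := by simp only [hd]; gcongr
          _ ≤ 1 := ENNReal.mul_inv_le_one _
    exact ne_top_of_le_ne_top
      (ENNReal.add_ne_top.2 ⟨by simp, ENNReal.sum_ne_top.2 fun k _ => hd_top k s⟩) hle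
  refine ⟨φ, fun s => (⨆ k, d k s).toReal, ?_, ?_⟩
  · have hm : AEStronglyMeasurable (fun s => (⨆ k, d k s).toReal) ν :=
      msup.ennreal_toReal.aestronglyMeasurable
    rcases hp.eq_or_lt with h0 | h0
    · simpa [← h0, memLp_zero_iff_aestronglyMeasurable] using hm
    · refine ⟨hm, ?_⟩
      rw [eLpNorm_lt_top_iff_lintegral_rpow_enorm_lt_top (by simpa using h0) (by simp),
        ENNReal.toReal_ofReal hp]
      refine lt_of_le_of_lt ?_ hsum.lt_top
      calc ∫⁻ s, ‖(⨆ k, d k s).toReal‖ₑ ^ p ∂ν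
          ≤ ∫⁻ s, ∑' k, d k s ^ p ∂ν := by
            refine lintegral_mono fun s => ?_
            have h1 : ‖(⨆ k, d k s).toReal‖ₑ ≤ ⨆ k, d k s := by
              rw [Real.enorm_of_nonneg ENNReal.toReal_nonneg]
              exact ENNReal.ofReal_toReal_le
            -- The `p`-th power of a supremum is at most the sum of the `p`-th powers.
            refine (ENNReal.rpow_le_rpow h1 hp).trans ?_
            refine (ENNReal.rpow_le_rpow (z := p) (iSup_le fun k => ?_) hp).trans_eq
              (ENNReal.rpow_inv_rpow h0.ne' (∑' k, d k s ^ p))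
            rw [← ENNReal.rpow_rpow_inv h0.ne' (d k s)]
            exact ENNReal.rpow_le_rpow (ENNReal.le_tsum (f := fun k => d k s ^ p) k)
              (inv_nonneg.2 hp)
        _ = ∑' k, ∫⁻ s, d k s ^ p ∂ν := lintegral_tsum fun k => (md k).pow_const p
        _ ≤ ∑' k : ℕ, ((1 : ℝ≥0∞) / 2) ^ k := by
            refine ENNReal.tsum_le_tsum fun k => ?_
            simp only [hd, ENNReal.mul_rpow_of_nonneg _ _ hp]
            rw [lintegral_const_mul' _ _ (ENNReal.rpow_ne_top_of_nonneg hp (by simp))]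
            exact (hφ k).2 h0
  · filter_upwards [hsup] with s hs k
    have h := ENNReal.toReal_mono hs (le_iSup (fun k => d k s) k)
    simpa [hd, ENNReal.toReal_mul, ENNReal.toReal_add] using h

/-- Along a line `t ↦ ξ + t ζ` a convex risk measure is a finite convex function on `ℝ`, hence
continuous. -/
theorem IsConvexRiskMeasure.continuous_add_mul {S : Type*} [MeasurableSpace S] {ν : Measure S}
    {p : ℝ} {ρ : (S → ℝ) → ℝ} (hρ : IsConvexRiskMeasure ν p ρ) {ξ ζ : S → ℝ}
    (hξ : MemLp ξ (ENNReal.ofReal p) ν) (hζ : MemLp ζ (ENNReal.ofReal p) ν) :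
    Continuous fun t : ℝ => ρ fun s => ξ s + t * ζ s := by
  rw [← continuousOn_univ]
  refine ConvexOn.continuousOn isOpen_univ ⟨convex_univ, fun x _ y _ a b ha hb hab => ?_⟩
  obtain rfl : b = 1 - a := by linarith
  have h := hρ.convex _ _ (hξ.add (hζ.const_mul x)) (hξ.add (hζ.const_mul y)) a ha (by linarith)
  refine le_trans (le_of_eq (congrArg ρ (funext fun s => ?_))) h
  simp only [Pi.add_apply, smul_eq_mul]
  ring

/-- By monotonicity `ρ (ξs k)` is sandwiched between the values of `ρ` at `ξ ± ζ / (k + 1)`, which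
converge to `ρ ξ` because `ρ` is continuous along lines. -/
theorem IsConvexRiskMeasure.tendsto_of_mul_abs_sub_le {S : Type*} [MeasurableSpace S]
    {ν : Measure S} {p : ℝ} {ρ : (S → ℝ) → ℝ} (hρ : IsConvexRiskMeasure ν p ρ)
    {ξs : ℕ → S → ℝ} {ξ ζ : S → ℝ} (hξs : ∀ n, MemLp (ξs n) (ENNReal.ofReal p) ν)
    (hξ : MemLp ξ (ENNReal.ofReal p) ν) (hζ : MemLp ζ (ENNReal.ofReal p) ν)
    (hle : ∀ᵐ s ∂ν, ∀ k : ℕ, ((k : ℝ) + 1) * |ξs k s - ξ s| ≤ ζ s) :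
    Tendsto (fun k => ρ (ξs k)) atTop (𝓝 (ρ ξ)) := by
  have hcont := hρ.continuous_add_mul hξ hζ
  have hlim : ∀ c : ℝ, Tendsto (fun k : ℕ => ρ fun s => ξ s + c * (1 / ((k : ℝ) + 1)) * ζ s)
      atTop (𝓝 (ρ ξ)) := by
    intro c
    have h1 : Tendsto (fun k : ℕ => c * (1 / ((k : ℝ) + 1))) atTop (𝓝 0) := by
      simpa using (tendsto_one_div_add_atTop_nhds_zero_nat (𝕜 := ℝ)).const_mul c
    have h2 := (hcont.tendsto 0).comp h1
    simpa [Function.comp_def] using h2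
  have habs : ∀ᵐ s ∂ν, ∀ k : ℕ, |ξs k s - ξ s| ≤ 1 / ((k : ℝ) + 1) * ζ s := by
    filter_upwards [hle] with s hs k
    have hk : (0 : ℝ) < (k : ℝ) + 1 := by positivity
    rw [one_div, ← div_eq_inv_mul, le_div_iff₀' hk]
    exact hs k
  refine tendsto_of_tendsto_of_tendsto_of_le_of_le (hlim (-1)) (hlim 1) (fun k => ?_) fun k => ?_
  · refine hρ.monotone _ _ (hξs k) (hξ.add (hζ.const_mul _)) ?_
    filter_upwards [habs] with s hs
    have := (abs_le.1 (hs k)).1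
    linarith
  · refine hρ.monotone _ _ (hξ.add (hζ.const_mul _)) (hξs k) ?_
    filter_upwards [habs] with s hs
    have := (abs_le.1 (hs k)).2
    linarith

/-! ### The functional on distributions induced by a risk measure -/

section riskOfLaw

variable {S : Type*} [MeasurableSpace S] {ν : Measure S} {U : S → ℝ}

theorem map_eq_restrict_Ioo_of_isUniform (hU_unif : pdf.IsUniform U (Icc (0 : ℝ) 1) ν) :
    ν.map U = volume.restrict (Ioo (0 : ℝ) 1) := by
  have h : ν.map U = _ := hU_unif
  rw [h, ProbabilityTheory.cond, restrict_Ioo_eq_restrict_Icc]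
  simp

theorem map_quantile_comp (hU : Measurable U) (hU_unif : pdf.IsUniform U (Icc (0 : ℝ) 1) ν)
    (m : Measure ℝ) [IsProbabilityMeasure m] : ν.map (fun s => quantile m (U s)) = m := by
  have hq : AEMeasurable (quantile m) (ν.map U) := by
    rw [map_eq_restrict_Ioo_of_isUniform hU_unif]
    exact aemeasurable_quantile m
  have h := AEMeasurable.map_map_of_aemeasurable hq hU.aemeasurable
  rw [map_eq_restrict_Ioo_of_isUniform hU_unif, map_quantile] at h
  exact h.symm

theorem aemeasurable_quantile_comp (hU : Measurable U)
    (hU_unif : pdf.IsUniform U (Icc (0 : ℝ) 1) ν) (m : Measure ℝ) :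
    AEMeasurable (fun s => quantile m (U s)) ν := by
  have hq : AEMeasurable (quantile m) (ν.map U) := by
    rw [map_eq_restrict_Ioo_of_isUniform hU_unif]
    exact aemeasurable_quantile m
  exact hq.comp_measurable hU

/-- The functional on distributions induced by a convex risk measure is sequentially continuous
for weak convergence together with convergence of the `p`-th absolute moments. -/
theorem tendsto_riskOfLaw [IsProbabilityMeasure ν] (hU : Measurable U)
    (hU_unif : pdf.IsUniform U (Icc (0 : ℝ) 1) ν) {p : ℝ} (hp : 0 ≤ p) {ρ : (S → ℝ) → ℝ}
    (hρ : IsConvexRiskMeasure ν p ρ) {m : ProbabilityMeasure ℝ} {ms : ℕ → ProbabilityMeasure ℝ}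
    (hm : Tendsto ms atTop (𝓝 m)) (hmem : MemLp id (ENNReal.ofReal p) (m : Measure ℝ))
    (hmems : ∀ n, MemLp id (ENNReal.ofReal p) (ms n : Measure ℝ))
    (hmom : Tendsto (fun n => ∫⁻ t, ‖t‖ₑ ^ p ∂(ms n : Measure ℝ)) atTop
      (𝓝 (∫⁻ t, ‖t‖ₑ ^ p ∂(m : Measure ℝ)))) :
    Tendsto (fun n => riskOfLaw ρ U (ms n)) atTop (𝓝 (riskOfLaw ρ U m)) := by
  have haem := aemeasurable_quantile_comp hU hU_unif
  have hmap : ∀ μ : ProbabilityMeasure ℝ, ν.map (fun s => quantile μ (U s)) = μ :=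
    fun μ => map_quantile_comp hU hU_unif μ
  have hLp : ∀ μ : ProbabilityMeasure ℝ, MemLp id (ENNReal.ofReal p) (μ : Measure ℝ) →
      MemLp (fun s => quantile μ (U s)) (ENNReal.ofReal p) ν := by
    intro μ hμ
    rw [← hmap μ] at hμ
    exact hμ.comp_of_map (haem μ)
  have hint : ∀ μ : ProbabilityMeasure ℝ,
      ∫⁻ s, ‖quantile μ (U s)‖ₑ ^ p ∂ν = ∫⁻ t, ‖t‖ₑ ^ p ∂(μ : Measure ℝ) := by
    intro μ
    conv_rhs => rw [← hmap μ]
    exact (lintegral_map' (f := fun t : ℝ => ‖t‖ₑ ^ p) (by fun_prop) (haem μ)).symm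
  refine tendsto_of_subseq_tendsto fun ns hns => ?_
  have hae : ∀ᵐ s ∂ν, Tendsto (fun n => quantile (ms (ns n)) (U s)) atTop
      (𝓝 (quantile m (U s))) := by
    have h := ae_tendsto_quantile (hm.comp hns)
    rw [← map_eq_restrict_Ioo_of_isUniform hU_unif] at h
    exact ae_of_ae_map hU.aemeasurable h
  obtain ⟨φ, ζ, hζ, hle⟩ := exists_subseq_mul_abs_sub_le hp (fun n => haem (ms (ns n))) (haem m)
    hae (fun h0 => tendsto_lintegral_enorm_sub_rpow h0 (fun n => haem (ms (ns n))) (haem m) hae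
      (by
        simp only [hint]
        exact hmom.comp hns)
      (by
        have h := (eLpNorm_lt_top_iff_lintegral_rpow_enorm_lt_top (by simpa using h0)
          (by simp)).1 (hLp m hmem).2
        rw [ENNReal.toReal_ofReal hp] at h
        exact h.ne))
  exact ⟨φ, hρ.tendsto_of_mul_abs_sub_le (fun k => hLp _ (hmems (ns (φ k)))) (hLp m hmem) hζ hle⟩

end riskOfLaw

/-! ### The moment-weak topology -/

theorem MomentMeasure.continuous_integral {d : ℕ} {q : ℝ} {h : EuclideanSpace ℝ (Fin d) → ℝ}
    (hh : h ∈ growthFunctions d q) :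
    Continuous fun P : MomentMeasure d q => ∫ t, h t ∂P.law :=
  continuous_iff_le_induced.2 (iInf₂_le h hh)

section IsMomentWeaklyContinuous

variable {T : Type*} [TopologicalSpace T] {d : ℕ} {𝒴 : Set (EuclideanSpace ℝ (Fin d))} {q : ℝ}

theorem IsMomentWeaklyContinuous.integrable {Q : T → Measure 𝒴}
    (hQ : IsMomentWeaklyContinuous q Q) (x : T) :
    Integrable (fun y : 𝒴 => ‖(y : EuclideanSpace ℝ (Fin d))‖ ^ q) (Q x) := by
  obtain ⟨M, hM, -⟩ := hQ
  have h := (M x).integrable_moment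
  rw [hM x] at h
  exact h.comp_measurable measurable_subtype_coe

theorem IsMomentWeaklyContinuous.continuous_lintegral {Q : T → Measure 𝒴}
    (hQ : IsMomentWeaklyContinuous q Q) (hq : 0 ≤ q) {C : ℝ} (hC : 0 ≤ C) :
    Continuous fun x => ∫⁻ y, ENNReal.ofReal
      (C * (‖(y : EuclideanSpace ℝ (Fin d))‖ ^ q + 1)) ∂Q x := by
  obtain ⟨M, hM, hMc⟩ := hQ
  have hcont : Continuous fun t : EuclideanSpace ℝ (Fin d) => C * (‖t‖ ^ q + 1) :=
    continuous_const.mul ((continuous_norm.rpow_const fun _ => Or.inr hq).add continuous_const)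
  have hnn : ∀ t : EuclideanSpace ℝ (Fin d), 0 ≤ ‖t‖ ^ q + 1 := fun t => by positivity
  have hgrow : (fun t : EuclideanSpace ℝ (Fin d) => C * (‖t‖ ^ q + 1)) ∈ growthFunctions d q := by
    refine ⟨hcont, C + 1, by positivity, fun t => ?_⟩
    rw [abs_of_nonneg (mul_nonneg hC (hnn t))]
    exact mul_le_mul_of_nonneg_right (by linarith) (hnn t)
  have h := ENNReal.continuous_ofReal.comp ((MomentMeasure.continuous_integral hgrow).comp hMc)
  refine h.congr fun x => ?_
  have := (M x).isProbabilityMeasure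
  have hint : Integrable (fun t => C * (‖t‖ ^ q + 1)) (M x).law :=
    ((M x).integrable_moment.add (integrable_const 1)).const_mul C
  simp only [Function.comp_apply]
  rw [ofReal_integral_eq_lintegral_ofReal hint
    (Eventually.of_forall fun t => mul_nonneg hC (hnn t)), hM x,
    lintegral_map hcont.measurable.ennreal_ofReal measurable_subtype_coe]

/-- Continuity in the moment-weak topology, formulated for measures on `ℝ^d`, entails weak
continuity on the subspace `𝒴`, which need not be measurable: by the portmanteau theorem it is
enough to test open sets, and those of `𝒴` are traces of open sets of `ℝ^d`. -/
theorem IsMomentWeaklyContinuous.continuous_probabilityMeasure [FirstCountableTopology T]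
    {Q : T → ProbabilityMeasure 𝒴} (hQ : IsMomentWeaklyContinuous q fun x => (Q x : Measure 𝒴)) :
    Continuous Q := by
  obtain ⟨M, hM, hMc⟩ := hQ
  let R : T → ProbabilityMeasure (EuclideanSpace ℝ (Fin d)) := fun x =>
    ⟨(M x).law, (M x).isProbabilityMeasure⟩
  have hR : Continuous R := by
    refine continuous_iff_continuousAt.2 fun x => ?_
    refine ProbabilityMeasure.tendsto_iff_forall_integral_tendsto.2 fun f => ?_
    have hf : (f : EuclideanSpace ℝ (Fin d) → ℝ) ∈ growthFunctions d q := by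
      refine ⟨f.continuous, ‖f‖ + 1, by positivity, fun t => ?_⟩
      have h1 : |f t| ≤ ‖f‖ := f.norm_coe_le_norm t
      have h2 : 0 ≤ ‖t‖ ^ q := by positivity
      nlinarith [norm_nonneg f]
    exact ((MomentMeasure.continuous_integral hf).comp hMc).tendsto x
  refine continuous_iff_continuousAt.2 fun x => ?_
  refine tendsto_of_forall_isOpen_le_liminf' fun G hG => ?_
  obtain ⟨O, hO, rfl⟩ := isOpen_induced_iff.1 hG
  have h := ProbabilityMeasure.le_liminf_measure_open_of_tendsto (hR.tendsto x) hO
  have hQO : ∀ x', (Q x' : Measure 𝒴) (Subtype.val ⁻¹' O) = (M x').law O := fun x' => by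
    rw [hM x', Measure.map_apply measurable_subtype_coe hO.measurableSet]
  simp only [hQO]
  exact h

end IsMomentWeaklyContinuous

/-! ### Costs of polynomial growth -/

theorem rpow_le_of_le_mul_rpow_add_one {a b r p q : ℝ} (ha : 0 ≤ a) (hb : 0 ≤ b) (hr : 0 ≤ r)
    (hp : 0 ≤ p) (h : a ≤ b * (r ^ q + 1)) :
    a ^ p ≤ (b * 2) ^ p * (r ^ (q * p) + 1) := by
  have hrq : 0 ≤ r ^ q := Real.rpow_nonneg hr q
  have h1 : a ≤ b * 2 * max (r ^ q) 1 := by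
    refine h.trans ?_
    rw [mul_assoc]
    refine mul_le_mul_of_nonneg_left ?_ hb
    linarith [le_max_left (r ^ q) 1, le_max_right (r ^ q) 1]
  have hmax : (0 : ℝ) ≤ max (r ^ q) 1 := le_max_of_le_left hrq
  calc a ^ p ≤ (b * 2 * max (r ^ q) 1) ^ p := Real.rpow_le_rpow ha h1 hp
    _ = (b * 2) ^ p * max (r ^ q) 1 ^ p := Real.mul_rpow (by positivity) hmax
    _ ≤ (b * 2) ^ p * (r ^ (q * p) + 1) := by
        refine mul_le_mul_of_nonneg_left ?_ (by positivity)
        rw [Real.rpow_mul hr]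
        rcases max_cases (r ^ q) 1 with h | h <;> rw [h.1]
        · exact le_add_of_nonneg_right zero_le_one
        · rw [Real.one_rpow]
          exact le_add_of_nonneg_left (Real.rpow_nonneg hrq p)

theorem memLp_of_rpow_le {T : Type*} [MeasurableSpace T] {μ : Measure T} {p : ℝ} (hp : 0 ≤ p)
    {f G : T → ℝ} (hf : AEStronglyMeasurable f μ) (hG : Integrable G μ)
    (hle : ∀ t, |f t| ^ p ≤ G t) : MemLp f (ENNReal.ofReal p) μ := by
  rcases hp.eq_or_lt with h0 | h0
  · simpa [← h0, memLp_zero_iff_aestronglyMeasurable] using hf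
  · rw [← integrable_norm_rpow_iff hf (by simpa using h0) (by simp), ENNReal.toReal_ofReal hp]
    refine hG.mono' ((hf.norm.aemeasurable.pow_const p).aestronglyMeasurable)
      (Eventually.of_forall fun t => ?_)
    rw [Real.norm_of_nonneg (Real.rpow_nonneg (norm_nonneg _) p)]
    exact hle t

/-- The law of `(x, y)` with `y` distributed according to `Q x` depends weakly continuously on `x`
if `Q` does; this turns an integrand depending on `x` into a fixed function of two variables. -/
theorem continuous_diracProba_prod {X T : Type*} [TopologicalSpace X] [TopologicalSpace T]
    [MeasurableSpace X] [MeasurableSpace T] [SecondCountableTopology X]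
    [SecondCountableTopology T] [TopologicalSpace.PseudoMetrizableSpace X]
    [TopologicalSpace.PseudoMetrizableSpace T] [OpensMeasurableSpace X] [OpensMeasurableSpace T]
    {Q : X → ProbabilityMeasure T} (hQ : Continuous Q) :
    Continuous fun x => (diracProba x).prod (Q x) :=
  ProbabilityMeasure.continuous_prod.comp (continuous_diracProba.prodMk hQ)

end

/-! ### Continuity of the risk of the cost -/

theorem mainTheorem2
    {dx dy dz : ℕ}
    (𝒳 : Set (EuclideanSpace ℝ (Fin dx)))
    (𝒴 : Set (EuclideanSpace ℝ (Fin dy)))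
    (𝒵 : Set (EuclideanSpace ℝ (Fin dz)))
    -- the random vectors `X`, `Y` and the conditional distribution `κ x` of `Y` given `X = x`
    {Ω : Type*} [MeasurableSpace Ω] (P : Measure Ω) [IsProbabilityMeasure P]
    (X : Ω → 𝒳) (Y : Ω → 𝒴) (hX : Measurable X) (hY : Measurable Y)
    (κ : Kernel 𝒳 𝒴) [IsMarkovKernel κ]
    (hκ : (P.map (fun ω => (X ω, Y ω))).IsCondKernel κ)
    -- (a) a law-invariant convex risk measure on `L^p` of a probability space which carries a
    -- uniformly distributed random variable `U` (equivalently, is nonatomic)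
    {S : Type*} [MeasurableSpace S] (ν : Measure S) [IsProbabilityMeasure ν]
    (U : S → ℝ) (hU : Measurable U) (hU_unif : pdf.IsUniform U (Set.Icc (0 : ℝ) 1) ν)
    (p : ℝ) (hp : 0 ≤ p)
    (ρ : (S → ℝ) → ℝ) (hρ : IsConvexRiskMeasure ν p ρ) (hρ_law : IsLawInvariant ν p ρ)
    -- (b) a continuous policy
    (g : 𝒳 → 𝒵) (hg : Continuous g)
    -- (c) a continuous cost function with a growth bound
    (c : EuclideanSpace ℝ (Fin dz) × EuclideanSpace ℝ (Fin dy) → ℝ)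
    (hc : ContinuousOn c (𝒵 ×ˢ 𝒴))
    (ι : ℝ) (hι : 0 ≤ ι)
    (η : 𝒵 → ℝ) (hη_nonneg : ∀ z, 0 ≤ η z) (hη : IsLocallyBounded η)
    (hgrowth : ∀ (z : 𝒵) (y : 𝒴), |c (z, y)| ≤ η z * (‖(y : EuclideanSpace ℝ (Fin dy))‖ ^ ι + 1))
    -- (d) continuity of the conditional distribution in the `‖·‖^(ι p)`-weak topology
    (hκ_cont : IsMomentWeaklyContinuous (ι * p) (fun x : 𝒳 => κ x)) :
    (∀ x : 𝒳, MemLp (fun y : 𝒴 => c (g x, y)) (ENNReal.ofReal p) (κ x)) ∧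
    Continuous (fun x : 𝒳 => riskUnder ρ U (κ x) (fun y : 𝒴 => c (g x, y))) := by
  have hf : Continuous fun xy : 𝒳 × 𝒴 => c (g xy.1, xy.2) :=
    hc.comp_continuous (by fun_prop) fun xy => ⟨(g xy.1).2, xy.2.2⟩
  have hfx : ∀ x : 𝒳, Continuous fun y : 𝒴 => c (g x, y) := fun x =>
    hf.comp (Continuous.prodMk_right x)
  have hbound : ∀ (x : 𝒳) (b : ℝ), η (g x) ≤ b → ∀ y : 𝒴, |c (g x, y)| ^ p
      ≤ (b * 2) ^ p * (‖(y : EuclideanSpace ℝ (Fin dy))‖ ^ (ι * p) + 1) := by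
    intro x b hb y
    refine rpow_le_of_le_mul_rpow_add_one (abs_nonneg _) ((hη_nonneg _).trans hb) (norm_nonneg _)
      hp ((hgrowth (g x) y).trans (mul_le_mul_of_nonneg_right hb (by positivity)))
  have hLp : ∀ x : 𝒳, MemLp (fun y : 𝒴 => c (g x, y)) (ENNReal.ofReal p) (κ x) := fun x =>
    memLp_of_rpow_le hp (hfx x).measurable.aestronglyMeasurable
      (((hκ_cont.integrable x).add (integrable_const 1)).const_mul _) (hbound x _ le_rfl)
  refine ⟨hLp, continuous_iff_seqContinuous.2 fun xs x hxs => ?_⟩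
  have hιp : 0 ≤ ι * p := mul_nonneg hι hp
  -- `K x`, `J x` and `L x` are the laws of `y`, of `(x, y)` and of the cost `c (g x, y)`.
  let K : 𝒳 → ProbabilityMeasure 𝒴 := fun x => ⟨κ x, inferInstance⟩
  have hK : Continuous K := IsMomentWeaklyContinuous.continuous_probabilityMeasure hκ_cont
  let J : 𝒳 → ProbabilityMeasure (𝒳 × 𝒴) := fun x => (diracProba x).prod (K x)
  have hJ : Continuous J := continuous_diracProba_prod hK
  have hJmap : ∀ x, (J x : Measure (𝒳 × 𝒴)) = (κ x).map (Prod.mk x) := fun x =>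
    Measure.dirac_prod x
  let L : 𝒳 → ProbabilityMeasure ℝ := fun x => (J x).map hf.measurable.aemeasurable
  have hL : Filter.Tendsto (fun n => L (xs n)) Filter.atTop (𝓝 (L x)) :=
    ProbabilityMeasure.tendsto_map_of_tendsto_of_continuous _ _ ((hJ.tendsto x).comp hxs) hf
  have hLmap : ∀ x, (L x : Measure ℝ) = (κ x).map fun y : 𝒴 => c (g x, y) := by
    intro x
    change (J x : Measure (𝒳 × 𝒴)).map _ = _
    rw [hJmap, Measure.map_map hf.measurable measurable_prodMk_left]
    rfl
  have hLmem : ∀ x, MemLp id (ENNReal.ofReal p) (L x : Measure ℝ) := by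
    intro x
    rw [hLmap]
    exact (memLp_map_measure_iff aestronglyMeasurable_id (hfx x).measurable.aemeasurable).2 (hLp x)
  have hrisk : ∀ x, riskUnder ρ U (κ x) (fun y : 𝒴 => c (g x, y)) = riskOfLaw ρ U (L x) := by
    intro x
    rw [riskUnder, hLmap]
  simp only [Function.comp_def, hrisk]
  refine tendsto_riskOfLaw hU hU_unif hp hρ hL (hLmem x) (fun n => hLmem (xs n)) ?_
  -- It remains to prove convergence of the `p`-th absolute moments of the costs.
  obtain ⟨s, hs, b, hb⟩ := hη (g x)
  have hb₀ : 0 ≤ b := (abs_nonneg _).trans (hb _ (mem_of_mem_nhds hs))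
  let F : 𝒳 × 𝒴 → ℝ := fun xy => |c (g xy.1, xy.2)| ^ p
  let G : 𝒳 × 𝒴 → ℝ := fun xy =>
    (b * 2) ^ p * (‖(xy.2 : EuclideanSpace ℝ (Fin dy))‖ ^ (ι * p) + 1)
  have hF : Continuous F := hf.abs.rpow_const fun _ => Or.inr hp
  have hG : Continuous G := continuous_const.mul
    (((continuous_subtype_val.comp continuous_snd).norm.rpow_const fun _ => Or.inr hιp).add
      continuous_const)
  have hmomJ : ∀ x, ∫⁻ t, ‖t‖ₑ ^ p ∂(L x : Measure ℝ)
      = ∫⁻ xy, ENNReal.ofReal (F xy) ∂(J x : Measure (𝒳 × 𝒴)) := by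
    intro x
    change ∫⁻ t, ‖t‖ₑ ^ p ∂((J x : Measure (𝒳 × 𝒴)).map _) = _
    rw [lintegral_map (by fun_prop) hf.measurable]
    refine lintegral_congr fun xy => ?_
    rw [Real.enorm_eq_ofReal_abs, ENNReal.ofReal_rpow_of_nonneg (abs_nonneg _) hp]
  have hGJ : ∀ x, ∫⁻ xy, ENNReal.ofReal (G xy) ∂(J x : Measure (𝒳 × 𝒴))
      = ∫⁻ y, ENNReal.ofReal
        ((b * 2) ^ p * (‖(y : EuclideanSpace ℝ (Fin dy))‖ ^ (ι * p) + 1)) ∂κ x := by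
    intro x
    rw [hJmap, lintegral_map hG.measurable.ennreal_ofReal measurable_prodMk_left]
  have hFG : ∀ x, g x ∈ s → ∀ᵐ xy ∂(J x : Measure (𝒳 × 𝒴)), F xy ≤ G xy := by
    intro x hx
    rw [hJmap, ae_map_iff measurable_prodMk_left.aemeasurable
      (measurableSet_le hF.measurable hG.measurable)]
    exact Filter.Eventually.of_forall (hbound x b ((le_abs_self _).trans (hb _ hx)))
  simp only [hmomJ]
  refine tendsto_lintegral_of_le_of_tendsto_lintegral
    (fun O hO => ProbabilityMeasure.le_liminf_measure_open_of_tendsto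
      ((hJ.tendsto x).comp hxs) hO) hF hG (fun xy => Real.rpow_nonneg (abs_nonneg _) p)
    (hFG x (mem_of_mem_nhds hs)) ?_ ?_ ?_
  · filter_upwards [((hg.tendsto x).comp hxs).eventually hs] with n hn
    exact hFG _ hn
  · simp only [Function.comp_apply, hGJ]
    have hC : 0 ≤ (b * 2) ^ p := by positivity
    exact ((hκ_cont.continuous_lintegral hιp hC).tendsto x).comp hxs
  · rw [hGJ]
    exact (((hκ_cont.integrable x).add (integrable_const 1)).const_mul _).lintegral_lt_top.ne
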